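/- Throughout, $C^*$-algebras are complex and unital, and for a self-adjoint element $X$ with spectrum $\sigma(X)$ and a real function $h$ that is continuous on $\sigma(X)$, $h(X)$ denotes the continuous functional calculus. A function $h\colon(0,\infty)\to\mathbb{R}$ is operator monotone (respectively operator monotone decreasing) if, for every unital $C^*$-algebra $C$ and all self-adjoint $X,Y\in C$ with $\sigma(X),\sigma(Y)\subset(0,\infty)$ for which $h(X)$ and $h(Y)$ are defined, $X\le Y$ implies $h(X)\le h(Y)$ (respectively $h(X)\ge h(Y)$); such a function is automatically continuous. Write $A^{++}$ for the set of invertible positive elements of a unital $C^*$-algebra $A$. A linear map $\Phi\colon A\to B$ between unital $C^*$-algebras is strictly positive if $\Phi(A^{++})\subset B^{++}$. Theorem. Let $f\colon(0,\infty)\to(0,\infty)$ be operator monotone decreasing and let $g\colon(0,\infty)\to\mathbb{R}$ be operator monotone. Let $A$ and $B$ be unital $C^*$-algebras and let $\Phi\colon A\to B$ be a strictly positive linear map. Then the map $A^{++}\to B$, $X\mapsto g(\Phi(f(X)))$, is convex: for all $X,Y\in A^{++}$ and $0\le t\le 1$, $$g\bigl(\Phi(f(tX+(1-t)Y))\bigr)\le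 t\,g\bigl(\Phi(f(X))\bigr)+(1-t)\,g\bigl(\Phi(f(Y))\bigr).$$ -/

import Mathlib

universe u v

/-- A real function `f` on a set `I` of real numbers is *operator monotone* on `I` if, in every
unital C⋆-algebra `A`, `X ≤ Y` implies `f(X) ≤ f(Y)` for all self-adjoint `X`, `Y` in `A` with
spectra in `I`. Here `f(X)` is the continuous functional calculus. The function `f` is not assumed
to be continuous: the inequality is imposed for those `X`, `Y` at which the functional calculus is
defined, that is, `f` is continuous on both spectra. This includes all elements with finite
spectrum, in particular all Hermitian matrices with eigenvalues in `I`. -/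
def IsOperatorMonotoneOn (I : Set ℝ) (f : ℝ → ℝ) : Prop :=
  ∀ (A : Type u) [CStarAlgebra A] [PartialOrder A] [StarOrderedRing A] (X Y : A),
    IsSelfAdjoint X → IsSelfAdjoint Y → spectrum ℝ X ⊆ I → spectrum ℝ Y ⊆ I →
    ContinuousOn f (spectrum ℝ X) → ContinuousOn f (spectrum ℝ Y) →
    X ≤ Y → cfc f X ≤ cfc f Y

/-- A real function `f` on `I` is *operator monotone decreasing* on `I` if, in every unital
C⋆-algebra, `X ≤ Y` implies `f(X) ≥ f(Y)` for all self-adjoint `X`, `Y` with spectra in `I` (at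
which the functional calculus by `f` is defined). -/
def IsOperatorMonotoneDecreasingOn (I : Set ℝ) (f : ℝ → ℝ) : Prop :=
  ∀ (A : Type u) [CStarAlgebra A] [PartialOrder A] [StarOrderedRing A] (X Y : A),
    IsSelfAdjoint X → IsSelfAdjoint Y → spectrum ℝ X ⊆ I → spectrum ℝ Y ⊆ I →
    ContinuousOn f (spectrum ℝ X) → ContinuousOn f (spectrum ℝ Y) →
    X ≤ Y → cfc f Y ≤ cfc f X

/-- A linear map between unital C⋆-algebras is *strictly positive* if it maps invertible positive
elements to invertible positive elements. -/
def IsStrictlyPositiveMap {A : Type u} {B : Type v}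
    [CStarAlgebra A] [PartialOrder A] [CStarAlgebra B] [PartialOrder B]
    (Φ : A →ₗ[ℂ] B) : Prop :=
  ∀ X : A, IsStrictlyPositive X → IsStrictlyPositive (Φ X)

open Set Filter Topology

/-! ### Functional calculus of pairs under ⋆-homomorphisms. -/

section Preliminaries

/-! Everything passes through the weighted harmonic mean `(aP⁻¹ + bQ⁻¹)⁻¹`. An operator monotone
function on the half-line is operator concave (`concaveOn_cfc`). For `1/f` this puts `f(aX + bY)`
below the harmonic mean of `f(X)` and `f(Y)`; for `-g(1/x)` it puts `g` of a harmonic mean below the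
arithmetic mean of the values of `g`. In between, `map_harmonic_le` moves `Φ` inside the harmonic
mean, and monotonicity of `g` joins the estimates.

Concavity comes from comparing a rotated `diag(X, Y)` with a diagonal 2×2 matrix and reading off a
corner; scalar instances of the same comparison give continuity. The estimate for `Φ` rests on
Choi's inequality, reduced to a Kadison inequality that Bernstein polynomials prove without complete
positivity. -/

lemma CStarAlgebra.exists_star_mul_self_eq {C : Type*} [CStarAlgebra C] [PartialOrder C]
    [StarOrderedRing C] {x : C} (hx : 0 ≤ x) : ∃ y : C, x = star y * y :=
  CStarAlgebra.nonneg_iff_eq_star_mul_self.mp hx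

open scoped CStarAlgebra in
lemma StarAlgHom.continuous_of_cstar {C D : Type*} [CStarAlgebra C] [CStarAlgebra D] (φ : D →⋆ₐ[ℂ] C) :
    Continuous φ :=
  map_continuous φ

/-- A ⋆-homomorphism commutes with the functional calculus, which acts on a pair componentwise, and
it does not enlarge the spectrum. -/
lemma IsOperatorMonotoneOn.starAlgHom_cfc_le {A : Type*} {C : Type v} [CStarAlgebra A]
    [CStarAlgebra C] [PartialOrder C] [StarOrderedRing C] {I : Set ℝ} {g : ℝ → ℝ}
    (hg : IsOperatorMonotoneOn.{v} I g) (φ ψ : A × A →⋆ₐ[ℂ] C) {X Y P Q : A}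
    (hX : IsSelfAdjoint X) (hY : IsSelfAdjoint Y) (hP : IsSelfAdjoint P) (hQ : IsSelfAdjoint Q)
    (hXI : spectrum ℝ X ⊆ I) (hYI : spectrum ℝ Y ⊆ I)
    (hPI : spectrum ℝ P ⊆ I) (hQI : spectrum ℝ Q ⊆ I)
    (hgXY : ContinuousOn g (spectrum ℝ X ∪ spectrum ℝ Y))
    (hgPQ : ContinuousOn g (spectrum ℝ P ∪ spectrum ℝ Q)) (h : φ (X, Y) ≤ ψ (P, Q)) :
    φ (cfc g X, cfc g Y) ≤ ψ (cfc g P, cfc g Q) := by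
  have hsa {U V : A} (hU : IsSelfAdjoint U) (hV : IsSelfAdjoint V) : IsSelfAdjoint (U, V) :=
    Prod.ext hU hV
  have hcont (χ : A × A →⋆ₐ[ℂ] C) : Continuous χ := StarAlgHom.continuous_of_cstar χ
  have : ContinuousFunctionalCalculus ℝ (A × A) IsSelfAdjoint :=
    IsSelfAdjoint.instContinuousFunctionalCalculus (A := A × A)
  have hspec (χ : A × A →⋆ₐ[ℂ] C) (U V : A) :
      spectrum ℝ (χ (U, V)) ⊆ spectrum ℝ U ∪ spectrum ℝ V :=
    (AlgHom.spectrum_apply_subset (χ.restrictScalars ℝ) (U, V)).trans (Prod.spectrum_eq U V).le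
  have hcfc (χ : A × A →⋆ₐ[ℂ] C) {U V : A} (hU : IsSelfAdjoint U) (hV : IsSelfAdjoint V)
      (hc : ContinuousOn g (spectrum ℝ U ∪ spectrum ℝ V)) :
      χ (cfc g U, cfc g V) = cfc g (χ (U, V)) := by
    rw [← cfc_map_prod (S := ℂ) g U V hc (hsa hU hV) hU hV]
    exact χ.map_cfc g (U, V) (by rwa [Prod.spectrum_eq]) (hcont χ) (hsa hU hV)
      ((hsa hU hV).map χ)
  rw [hcfc φ hX hY hgXY, hcfc ψ hP hQ hgPQ]
  exact hg C _ _ ((hsa hX hY).map φ) ((hsa hP hQ).map ψ)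
    ((hspec φ X Y).trans (union_subset hXI hYI)) ((hspec ψ P Q).trans (union_subset hPI hQI))
    (hgXY.mono (hspec φ X Y)) (hgPQ.mono (hspec ψ P Q)) h

end Preliminaries

/-! ### Rotated diagonal 2×2 matrices. -/

namespace CStarMatrix

variable {A : Type*} [CStarAlgebra A] [PartialOrder A] [StarOrderedRing A]

/-- The `⋆`-homomorphism `A × A → M₂(A)` sending `(x, y)` to `Uᴴ * diag(x, y) * U`, where `U` is the
rotation by the angle with cosine `√a` and sine `√b`. -/
noncomputable def rotatedDiag (a b c : ℝ) (hab : a + b = 1) (hc : c * c = a * b) :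
    A × A →⋆ₐ[ℂ] CStarMatrix (Fin 2) (Fin 2) A where
  toFun z := ofMatrix !![a • z.1 + b • z.2, c • (z.2 - z.1); c • (z.2 - z.1), b • z.1 + a • z.2]
  map_one' := by
    ext i j
    fin_cases i <;> fin_cases j <;> simp [← add_smul, hab, add_comm b a]
  map_mul' x y := by
    obtain rfl : b = 1 - a := by linarith
    ext i j
    fin_cases i <;> fin_cases j <;>
      simp [mul_apply, Fin.sum_univ_two, mul_add, add_mul, mul_sub, sub_mul, smul_smul] <;>
      match_scalars <;>
      first | ring1 | linear_combination hc | linear_combination -hc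
  map_zero' := by
    ext i j
    fin_cases i <;> fin_cases j <;> simp
  map_add' x y := by
    ext i j
    fin_cases i <;> fin_cases j <;> simp <;> module
  commutes' r := by
    ext i j
    fin_cases i <;> fin_cases j <;>
      simp [algebraMap_apply, ← add_smul, hab, add_comm b a]
  map_star' x := by
    ext i j
    fin_cases i <;> fin_cases j <;> simp [star_apply]

lemma apply_self_nonneg {n : Type*} [Fintype n] [DecidableEq n] {M : CStarMatrix n n A}
    (hM : 0 ≤ M) (i : n) : 0 ≤ M i i := by
  obtain ⟨N, rfl⟩ := CStarAlgebra.exists_star_mul_self_eq hM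
  rw [mul_apply]
  exact Finset.sum_nonneg fun j _ => by simp [star_apply]

/-- The off-diagonal entries are absorbed by adding `ε` in one corner and a large scalar in the
other. -/
lemma rotatedDiag_le {a b c ε lam : ℝ} (hab : a + b = 1) (hc : c * c = a * b) (hε : 0 < ε)
    {X Y : A} (hX : IsSelfAdjoint X) (hY : IsSelfAdjoint Y)
    (hlam : b • X + a • Y + (ε⁻¹ * (c * c)) • ((Y - X) * (Y - X)) ≤ algebraMap ℝ A lam) :
    rotatedDiag a b c hab hc (X, Y) ≤
      rotatedDiag 1 0 0 (by norm_num) (by norm_num)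
        (a • X + b • Y + algebraMap ℝ A ε, algebraMap ℝ A lam) := by
  obtain ⟨q, hq⟩ := CStarAlgebra.exists_star_mul_self_eq (sub_nonneg.mpr hlam)
  -- Cholesky factor of the difference: `q` is a root of the Schur complement.
  let N : CStarMatrix (Fin 2) (Fin 2) A :=
    ofMatrix !![algebraMap ℝ A (√ε), -((√ε)⁻¹ * c) • (Y - X); 0, q]
  have hs : √ε * √ε = ε := Real.mul_self_sqrt hε.le
  have hs0 : √ε ≠ 0 := (Real.sqrt_pos.mpr hε).ne'
  have hi : (√ε)⁻¹ * (√ε)⁻¹ = ε⁻¹ := by rw [← mul_inv, hs]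
  have key : rotatedDiag 1 0 0 (by norm_num) (by norm_num)
        (a • X + b • Y + algebraMap ℝ A ε, algebraMap ℝ A lam)
        - rotatedDiag a b c hab hc (X, Y) = star N * N := by
    have hq' : algebraMap ℝ A lam =
        star q * q + (b • X + a • Y + (ε⁻¹ * (c * c)) • ((Y - X) * (Y - X))) := by
      rw [← hq]; abel
    rw [hq']
    ext i j
    fin_cases i <;> fin_cases j <;>
      simp [rotatedDiag, N, mul_apply, Fin.sum_univ_two, star_apply, hX.star_eq, hY.star_eq,
        Algebra.algebraMap_eq_smul_one, smul_smul, hs, hs0, mul_assoc]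
    · congr 1
      field_simp
    rw [show (√ε)⁻¹ * (c * ((√ε)⁻¹ * c)) = ε⁻¹ * (c * c) by rw [← hi]; ring]
    abel
  rw [← sub_nonneg, key]
  exact star_mul_self_nonneg N

end CStarMatrix

/-! ### Operator monotone functions are continuous and concave. -/

section Concavity

variable {A : Type u} [CStarAlgebra A] [PartialOrder A] [StarOrderedRing A]

lemma IsStrictlyPositive.spectrum_subset_Ioi {X : A} (hX : IsStrictlyPositive X) :
    spectrum ℝ X ⊆ Ioi 0 := fun _ hx => hX.spectrum_pos hx

lemma IsStrictlyPositive.convexComb {X Y : A} (hX : IsStrictlyPositive X)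
    (hY : IsStrictlyPositive Y) {a b : ℝ} (ha : 0 ≤ a) (hb : 0 ≤ b) (hab : a + b = 1) :
    IsStrictlyPositive (a • X + b • Y) := by
  rcases ha.eq_or_lt with rfl | ha'
  · obtain rfl : b = 1 := by linarith
    simpa using hY
  · exact (hX.smul ha').add_nonneg (smul_nonneg hb hY.nonneg)

/-- An operator monotone function on the half-line is operator concave up to an arbitrarily small
shift of the argument; no continuity is needed beyond the spectra involved. -/
lemma IsOperatorMonotoneOn.add_smul_cfc_le {g : ℝ → ℝ}
    (hg : IsOperatorMonotoneOn.{u} (Ioi 0) g) {X Y : A} (hX : IsStrictlyPositive X)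
    (hY : IsStrictlyPositive Y) {a b ε : ℝ} (ha : 0 ≤ a) (hb : 0 ≤ b) (hab : a + b = 1)
    (hε : 0 < ε) (hgX : ContinuousOn g (spectrum ℝ X)) (hgY : ContinuousOn g (spectrum ℝ Y))
    (hgW : ContinuousOn g (spectrum ℝ (a • X + b • Y + algebraMap ℝ A ε))) :
    a • cfc g X + b • cfc g Y ≤ cfc g (a • X + b • Y + algebraMap ℝ A ε) := by
  nontriviality A
  have hc : √(a * b) * √(a * b) = a * b := Real.mul_self_sqrt (mul_nonneg ha hb)
  set c := √(a * b)
  have hW : IsStrictlyPositive (a • X + b • Y + algebraMap ℝ A ε) :=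
    (hX.convexComb hY ha hb hab).add_nonneg (isStrictlyPositive_algebraMap hε).nonneg
  set T := b • X + a • Y + (ε⁻¹ * (c * c)) • ((Y - X) * (Y - X)) with hT
  have hXs := hX.isSelfAdjoint
  have hYs := hY.isSelfAdjoint
  have hTs : IsSelfAdjoint T := by
    have h2 : IsSelfAdjoint ((Y - X) * (Y - X)) := by
      have := IsSelfAdjoint.star_mul_self (Y - X)
      rwa [(hYs.sub hXs).star_eq] at this
    exact ((IsSelfAdjoint.smul (.all b) hXs).add (.smul (.all a) hYs)).add (.smul (.all _) h2)
  -- The `+ 1` keeps `lam` in the open half-line even when `T = 0`.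
  set lam := ‖T‖ + 1
  have hlam : 0 < lam := by positivity
  have hle : T ≤ algebraMap ℝ A lam :=
    hTs.le_algebraMap_norm_self.trans (algebraMap_mono A (by simp [lam]))
  have hlamP : IsStrictlyPositive (algebraMap ℝ A lam) := isStrictlyPositive_algebraMap hlam
  have hglam : ContinuousOn g (spectrum ℝ (algebraMap ℝ A lam)) := by
    rw [spectrum.scalar_eq]
    exact continuousOn_singleton g lam
  have key := hg.starAlgHom_cfc_le _ _ hXs hYs hW.isSelfAdjoint hlamP.isSelfAdjoint
    hX.spectrum_subset_Ioi hY.spectrum_subset_Ioi hW.spectrum_subset_Ioi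
    hlamP.spectrum_subset_Ioi
    (hgX.union_of_isClosed hgY (spectrum.isClosed X) (spectrum.isClosed Y))
    (hgW.union_of_isClosed hglam (spectrum.isClosed _) (spectrum.isClosed _))
    (CStarMatrix.rotatedDiag_le hab hc hε hXs hYs hle)
  have := CStarMatrix.apply_self_nonneg (sub_nonneg.mpr key) 0
  simpa [CStarMatrix.rotatedDiag] using this

lemma IsOperatorMonotoneOn.scalar_midpoint_le [Nontrivial A] {g : ℝ → ℝ}
    (hg : IsOperatorMonotoneOn.{u} (Ioi 0) g) {x y z : ℝ} (hx : 0 < x) (hy : 0 < y)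
    (hz : x + y < 2 * z) : g x + g y ≤ 2 * g z := by
  have hs (r : ℝ) : ContinuousOn g (spectrum ℝ (algebraMap ℝ A r)) := by
    rw [spectrum.scalar_eq]
    exact continuousOn_singleton g r
  have hW : (1 / 2 : ℝ) • algebraMap ℝ A x + (1 / 2 : ℝ) • algebraMap ℝ A y
      + algebraMap ℝ A (z - (x + y) / 2) = algebraMap ℝ A z := by
    simp only [Algebra.algebraMap_eq_smul_one]
    module
  have := hg.add_smul_cfc_le (A := A) (isStrictlyPositive_algebraMap hx)
    (isStrictlyPositive_algebraMap hy) (a := 1 / 2) (b := 1 / 2) (ε := z - (x + y) / 2)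
    (by norm_num) (by norm_num) (by norm_num) (by linarith) (hs x) (hs y) (hW ▸ hs z)
  rw [hW, cfc_algebraMap, cfc_algebraMap, cfc_algebraMap] at this
  have h2 : algebraMap ℝ A ((g x + g y) / 2) ≤ algebraMap ℝ A (g z) := by
    refine le_trans (le_of_eq ?_) this
    simp only [Algebra.algebraMap_eq_smul_one]
    module
  have := (algebraMap_le_algebraMap (β := A)).mp h2
  linarith

/-- The case `x = y` gives monotonicity. A jump at a point is impossible: a value just to its right
is at most twice the left limit minus a value just to its left. -/
lemma continuousOn_Ioi_of_midpoint_le {g : ℝ → ℝ}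
    (hg : ∀ x y z : ℝ, 0 < x → 0 < y → x + y < 2 * z → g x + g y ≤ 2 * g z) :
    ContinuousOn g (Ioi 0) := by
  have hmono : ∀ x y : ℝ, 0 < x → x < y → g x ≤ g y := fun x y hx hxy => by
    linarith [hg x x y hx hx (by linarith)]
  refine fun x hx => ContinuousAt.continuousWithinAt (Metric.continuousAt_iff.mpr fun ε hε => ?_)
  have hx : 0 < x := hx
  set L := sSup (g '' Ioo 0 x)
  have hbdd : BddAbove (g '' Ioo 0 x) := by
    refine ⟨g x, ?_⟩
    rintro _ ⟨y, hy, rfl⟩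
    exact hmono y x hy.1 hy.2
  obtain ⟨_, ⟨y, hy, rfl⟩, hyL⟩ := exists_lt_of_lt_csSup
    ((nonempty_Ioo.mpr hx).image g) (show L - ε / 2 < L by linarith)
  have hle (z : ℝ) (h0 : 0 < z) (h1 : z < x) : g z ≤ L :=
    le_csSup hbdd (mem_image_of_mem g ⟨h0, h1⟩)
  have hy0 := hy.1
  have hyx := hy.2
  -- With this `h`, `x - 3h` exceeds `y`, and its midpoint with `x + h`, namely `x - h`, lies
  -- strictly below `x - h / 2 < x`.
  set h := (x - y) / 4
  have hh : h = (x - y) / 4 := rfl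
  have hbound (z : ℝ) (hz : y < z) (hzx : z < x + h) : L - ε / 2 < g z ∧ g z < L + ε / 2 := by
    refine ⟨hyL.trans_le (hmono y z hy0 hz), ?_⟩
    have h1 := hmono z (x + h) (by linarith) hzx
    have h2 := hg (x - 3 * h) (x + h) (x - h / 2) (by linarith) (by linarith) (by linarith)
    have h3 := hle (x - h / 2) (by linarith) (by linarith)
    have h4 := hmono y (x - 3 * h) hy0 (by linarith)
    linarith
  refine ⟨h, by linarith, fun {z} hz => ?_⟩
  rw [Real.dist_eq, abs_lt] at hz
  have h1 := hbound z (by linarith) (by linarith)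
  have h2 := hbound x hyx (by linarith)
  rw [Real.dist_eq, abs_lt]
  constructor <;> linarith

lemma IsOperatorMonotoneOn.continuousOn_Ioi (A : Type u) [CStarAlgebra A] [Nontrivial A]
    {g : ℝ → ℝ} (hg : IsOperatorMonotoneOn.{u} (Ioi 0) g) : ContinuousOn g (Ioi 0) := by
  let _ : PartialOrder A := CStarAlgebra.spectralOrder A
  have : StarOrderedRing A := CStarAlgebra.spectralOrderedRing A
  exact continuousOn_Ioi_of_midpoint_le fun _ _ _ => hg.scalar_midpoint_le (A := A)

/-- An operator monotone function on the half-line is operator concave. -/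
lemma IsOperatorMonotoneOn.concaveOn_cfc {g : ℝ → ℝ} (hg : IsOperatorMonotoneOn.{u} (Ioi 0) g) :
    ConcaveOn ℝ {X : A | IsStrictlyPositive X} (fun X => cfc g X) := by
  refine ⟨fun X hX Y hY a b ha hb hab => hX.convexComb hY ha hb hab,
    fun X hX Y hY a b ha hb hab => ?_⟩
  have hX : IsStrictlyPositive X := hX
  have hY : IsStrictlyPositive Y := hY
  nontriviality A
  have hgc := hg.continuousOn_Ioi A
  set W := a • X + b • Y with hWdef
  have hW : IsStrictlyPositive W := hX.convexComb hY ha hb hab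
  have hWε (ε : ℝ) (hε : 0 ≤ ε) : IsStrictlyPositive (W + algebraMap ℝ A ε) :=
    hW.add_nonneg (by simpa using algebraMap_mono A hε)
  have hcont : ContinuousOn (fun ε : ℝ => cfc g (W + algebraMap ℝ A ε)) (Ici 0) := by
    refine ContinuousOn.cfc_of_mem_nhdsSet g (s := Ioi 0) ?_ (by fun_prop)
      (fun ε hε => (hWε ε hε).isSelfAdjoint) hgc
    exact isOpen_Ioi.mem_nhdsSet.mpr (iUnion₂_subset fun ε hε => (hWε ε hε).spectrum_subset_Ioi)
  have hlim : Tendsto (fun ε : ℝ => cfc g (W + algebraMap ℝ A ε)) (𝓝[>] 0) (𝓝 (cfc g W)) := by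
    simpa using ((hcont 0 self_mem_Ici).mono Ioi_subset_Ici_self).tendsto
  refine ge_of_tendsto hlim (eventually_mem_nhdsWithin.mono fun ε (hε : 0 < ε) => ?_)
  exact hg.add_smul_cfc_le hX hY ha hb hab hε (hgc.mono hX.spectrum_subset_Ioi)
    (hgc.mono hY.spectrum_subset_Ioi) (hgc.mono (hWε ε hε.le).spectrum_subset_Ioi)

end Concavity

/-! ### Kadison and Choi inequalities, harmonic means. -/

section Kadison

variable {A : Type*} {B : Type*} [CStarAlgebra A] [PartialOrder A] [StarOrderedRing A]
  [CStarAlgebra B] [PartialOrder B] [StarOrderedRing B]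

/-- A positive linear map `Ψ` satisfies the weighted Kadison inequality
`Ψ(Z) Ψ(1)⁻¹ Ψ(Z) ≤ Ψ(Z²)` for positive contractions `Z`. -/
lemma LinearMap.mul_inverse_mul_le_map_sq {Ψ : A →ₗ[ℂ] B} (hΨ : ∀ x, 0 ≤ x → 0 ≤ Ψ x)
    (h1 : IsStrictlyPositive (Ψ 1)) {Z : A} (hZ0 : 0 ≤ Z) (hZ1 : Z ≤ 1) :
    Ψ Z * Ring.inverse (Ψ 1) * Ψ Z ≤ Ψ (Z * Z) := by
  have hZs : IsSelfAdjoint Z := .of_nonneg hZ0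
  set M := Ring.inverse (Ψ 1) * Ψ Z with hM
  have hDM : Ψ 1 * M = Ψ Z := by rw [hM, Ring.mul_inverse_cancel_left _ _ h1.isUnit]
  have hΨZ : star (Ψ Z) = Ψ Z := (IsSelfAdjoint.of_nonneg (hΨ Z hZ0)).star_eq
  have hMD : star M * Ψ 1 = Ψ Z := by
    have := congrArg star hDM
    rwa [star_mul, hΨZ, h1.isSelfAdjoint.star_eq] at this
  -- A positive partition of unity replacing the spectral measure of `Z`: the point `k / n` has
  -- weight `β n k`, with mean `Z` and second moment `Z² + (Z - Z²) / n`.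
  let β (n k : ℕ) : A := Polynomial.aeval Z (bernsteinPolynomial ℝ n k)
  have hβ (n k : ℕ) : 0 ≤ β n k := by
    rw [show β n k = cfc (bernsteinPolynomial ℝ n k).eval Z from (cfc_polynomial _ Z).symm]
    refine cfc_nonneg fun x hx => ?_
    have hx0 : 0 ≤ x := spectrum_nonneg_of_nonneg hZ0 hx
    have hx1 : x ≤ 1 := by
      have := (le_algebraMap_iff_spectrum_le (R := ℝ) (A := A) (r := 1) (a := Z)).mp (by simpa)
      exact this x hx
    have : 0 ≤ 1 - x := by linarith
    simp only [bernsteinPolynomial, Polynomial.eval_mul, Polynomial.eval_pow, Polynomial.eval_sub,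
      Polynomial.eval_X, Polynomial.eval_one, Polynomial.eval_natCast]
    positivity
  have hs0 (n : ℕ) : ∑ k ∈ Finset.range (n + 1), β n k = 1 := by
    simpa [β] using congrArg (Polynomial.aeval Z) (bernsteinPolynomial.sum ℝ n)
  have hs1 (n : ℕ) : ∑ k ∈ Finset.range (n + 1), (k : ℝ) • β n k = (n : ℝ) • Z := by
    simpa [β, Nat.cast_smul_eq_nsmul] using
      congrArg (Polynomial.aeval Z) (bernsteinPolynomial.sum_smul ℝ n)
  have hs2 (n : ℕ) : ∑ k ∈ Finset.range (n + 1), ((k : ℝ) ^ 2) • β n k =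
      ((n : ℝ) ^ 2) • (Z * Z) + (n : ℝ) • (Z - Z * Z) := by
    have := congrArg (Polynomial.aeval Z) (bernsteinPolynomial.sum_mul_smul ℝ n)
    simp only [map_sum, map_nsmul, map_pow, Polynomial.aeval_X] at this
    -- The Bernstein identity gives the factorial moment, with truncated subtraction.
    have h2 (k : ℕ) : (k : ℝ) ^ 2 = ((k * (k - 1) : ℕ) : ℝ) + k := by
      rcases k with _ | k
      · simp
      · rw [Nat.add_sub_cancel]
        push_cast
        ring
    simp_rw [h2, add_smul, Finset.sum_add_distrib, hs1, Nat.cast_smul_eq_nsmul]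
    rw [this, pow_two, smul_sub]
    abel
  have key (n : ℕ) (hn : 0 < n) :
      Ψ Z * M ≤ Ψ (Z * Z) + (n : ℝ)⁻¹ • Ψ (Z - Z * Z) := by
    have hreal (r : ℝ) (x : A) : Ψ (r • x) = r • Ψ x := Ψ.map_smul_of_tower r x
    have e0 : ∑ k ∈ Finset.range (n + 1), Ψ (β n k) = Ψ 1 := by rw [← map_sum, hs0]
    have e1 : ∑ k ∈ Finset.range (n + 1), (k : ℝ) • Ψ (β n k) = (n : ℝ) • Ψ Z := by
      simp_rw [← hreal, ← map_sum, hs1]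
    have e2 : ∑ k ∈ Finset.range (n + 1), ((k : ℝ) ^ 2) • Ψ (β n k) =
        ((n : ℝ) ^ 2) • Ψ (Z * Z) + (n : ℝ) • Ψ (Z - Z * Z) := by
      simp_rw [← hreal, ← map_sum, hs2, map_add]
    -- Nonnegativity of a variance about `M = Ψ(1)⁻¹ Ψ(Z)`; divided by `n²`, it is the claim up to
    -- `O(1/n)`.
    have hpos : 0 ≤ ∑ k ∈ Finset.range (n + 1),
        star ((k : ℝ) • (1 : B) - (n : ℝ) • M) * Ψ (β n k) * ((k : ℝ) • (1 : B) - (n : ℝ) • M) :=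
      Finset.sum_nonneg fun k _ => star_left_conjugate_nonneg (hΨ _ (hβ n k)) _
    have hexp (k : ℕ) :
        star ((k : ℝ) • (1 : B) - (n : ℝ) • M) * Ψ (β n k) * ((k : ℝ) • (1 : B) - (n : ℝ) • M) =
          ((k : ℝ) ^ 2) • Ψ (β n k) - (n : ℝ) • (star M * ((k : ℝ) • Ψ (β n k)))
            - (n : ℝ) • (((k : ℝ) • Ψ (β n k)) * M)
            + ((n : ℝ) ^ 2) • (star M * Ψ (β n k) * M) := by
      simp only [star_sub, star_smul, star_one, star_trivial, sub_mul, mul_sub, smul_mul_assoc,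
        mul_smul_comm, one_mul, mul_one, smul_smul]
      module
    simp_rw [hexp, Finset.sum_add_distrib, Finset.sum_sub_distrib, ← Finset.smul_sum,
      ← Finset.sum_mul, ← Finset.mul_sum, e0, e1, e2] at hpos
    have hMZ : star M * Ψ Z = Ψ Z * M := by rw [← hDM, ← mul_assoc, hMD, hDM]
    rw [hMD, mul_smul_comm, smul_mul_assoc, hMZ] at hpos
    have hn' : (n : ℝ) ≠ 0 := by positivity
    have := smul_nonneg (show (0 : ℝ) ≤ ((n : ℝ) ^ 2)⁻¹ by positivity) hpos
    rw [← sub_nonneg]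
    convert this using 1
    match_scalars <;> field_simp
    all_goals ring
  have hlim : Tendsto (fun n : ℕ => Ψ (Z * Z) + (n : ℝ)⁻¹ • Ψ (Z - Z * Z)) atTop
      (𝓝 (Ψ (Z * Z))) := by
    simpa using tendsto_const_nhds.add
      ((tendsto_inv_atTop_nhds_zero_nat (𝕜 := ℝ)).smul_const (Ψ (Z - Z * Z)))
  rw [mul_assoc]
  exact ge_of_tendsto hlim ((eventually_gt_atTop 0).mono key)

/-- A strictly positive linear map is positive. -/
lemma IsStrictlyPositiveMap.map_nonneg {A : Type u} {B : Type v}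
    [CStarAlgebra A] [PartialOrder A] [StarOrderedRing A]
    [CStarAlgebra B] [PartialOrder B] [StarOrderedRing B] {Φ : A →ₗ[ℂ] B}
    (hΦ : IsStrictlyPositiveMap Φ) {x : A} (hx : 0 ≤ x) : 0 ≤ Φ x := by
  have hlim : Tendsto (fun ε : ℝ => Φ x + ε • Φ 1) (𝓝[>] 0) (𝓝 (Φ x)) := by
    have : Continuous fun ε : ℝ => Φ x + ε • Φ 1 := by fun_prop
    simpa using (this.tendsto 0).mono_left nhdsWithin_le_nhds
  refine ge_of_tendsto hlim (eventually_mem_nhdsWithin.mono fun ε (hε : 0 < ε) => ?_)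
  have := (hΦ (x + ε • 1) ((isStrictlyPositive_one.smul hε).nonneg_add hx)).nonneg
  rwa [map_add, Φ.map_smul_of_tower] at this

/-- Choi's inequality `Φ(H) Φ(S)⁻¹ Φ(H) ≤ Φ(H S⁻¹ H)` for a strictly positive linear map. -/
lemma IsStrictlyPositiveMap.mul_inverse_mul_le {A : Type u} {B : Type v}
    [CStarAlgebra A] [PartialOrder A] [StarOrderedRing A]
    [CStarAlgebra B] [PartialOrder B] [StarOrderedRing B] {Φ : A →ₗ[ℂ] B}
    (hΦ : IsStrictlyPositiveMap Φ) {H S : A} (hH : 0 ≤ H) (hS : IsStrictlyPositive S) :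
    Φ H * Ring.inverse (Φ S) * Φ H ≤ Φ (H * Ring.inverse S * H) := by
  set s := CFC.sqrt S
  have hss : s * s = S := CFC.sqrt_mul_sqrt_self S hS.nonneg
  have hs : IsStrictlyPositive s := hS.sqrt
  set w := Ring.inverse s with hw
  have hws : w * s = 1 := Ring.inverse_mul_cancel _ hs.isUnit
  have hsw : s * w = 1 := Ring.mul_inverse_cancel _ hs.isUnit
  have hwp : IsStrictlyPositive w := hs.ringInverse
  have hww : w * w = Ring.inverse S := by
    rw [← hss, Ring.inverse_mul (.inl hs.isUnit)]
  set Z := w * H * w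
  have hZ : 0 ≤ Z := by
    simpa [hwp.isSelfAdjoint.star_eq] using star_left_conjugate_nonneg hH w
  -- Rescaling to a contraction is harmless: both sides are quadratic in `Z`.
  obtain ⟨r, hr, hr1⟩ : ∃ r : ℝ, 0 < r ∧ r • Z ≤ 1 := by
    refine ⟨(‖Z‖ + 1)⁻¹, by positivity, ?_⟩
    have h1 : Z ≤ algebraMap ℝ A (‖Z‖ + 1) :=
      (IsSelfAdjoint.of_nonneg hZ).le_algebraMap_norm_self.trans
        (algebraMap_mono A (by linarith))
    have h2 := smul_le_smul_of_nonneg_left h1 (show (0 : ℝ) ≤ (‖Z‖ + 1)⁻¹ by positivity)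
    have h3 : ‖Z‖ + 1 ≠ 0 := by positivity
    rwa [Algebra.algebraMap_eq_smul_one, smul_smul, inv_mul_cancel₀ h3, one_smul] at h2
  -- With `s = √S`, Kadison's inequality for `Ψ` at `Z = s⁻¹Hs⁻¹` is Choi's for `Φ`.
  let Ψ : A →ₗ[ℂ] B := Φ ∘ₗ LinearMap.mulLeftRight ℂ (s, s)
  have hΨ (x : A) : Ψ x = Φ (s * x * s) := rfl
  have hΨ1 : Ψ 1 = Φ S := by rw [hΨ, mul_one, hss]
  have hsZs : s * Z * s = H := by
    rw [show s * (w * H * w) * s = (s * w) * H * (w * s) by simp only [mul_assoc], hsw, hws]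
    simp
  have hsZZs : s * (Z * Z) * s = H * Ring.inverse S * H := by
    rw [← hww, show s * (w * H * w * (w * H * w)) * s = (s * w) * (H * (w * w) * H) * (w * s) by
      simp only [mul_assoc], hsw, hws]
    simp
  have key := LinearMap.mul_inverse_mul_le_map_sq (Ψ := Ψ)
    (fun x hx => hΦ.map_nonneg (by
      simpa [hs.isSelfAdjoint.star_eq] using star_left_conjugate_nonneg hx s))
    (hΨ1 ▸ hΦ S hS) (smul_nonneg hr.le hZ) hr1
  rw [smul_mul_smul_comm, Ψ.map_smul_of_tower, Ψ.map_smul_of_tower, hΨ1, hΨ Z, hΨ (Z * Z), hsZs,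
    hsZZs, smul_mul_assoc, smul_mul_smul_comm] at key
  exact (smul_le_smul_iff_of_pos_left (mul_pos hr hr)).mp key

/-- A strictly positive linear map is subadditive for weighted harmonic means. -/
lemma IsStrictlyPositiveMap.map_harmonic_le {A : Type u} {B : Type v}
    [CStarAlgebra A] [PartialOrder A] [StarOrderedRing A]
    [CStarAlgebra B] [PartialOrder B] [StarOrderedRing B] {Φ : A →ₗ[ℂ] B}
    (hΦ : IsStrictlyPositiveMap Φ) {P Q : A} (hP : IsStrictlyPositive P)
    (hQ : IsStrictlyPositive Q) {a b : ℝ} (ha : 0 ≤ a) (hb : 0 ≤ b) (hab : a + b = 1) :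
    Φ (Ring.inverse (a • Ring.inverse P + b • Ring.inverse Q)) ≤
      Ring.inverse (a • Ring.inverse (Φ P) + b • Ring.inverse (Φ Q)) := by
  set N := a • Ring.inverse P + b • Ring.inverse Q with hNdef
  have hN : IsStrictlyPositive N := hP.ringInverse.convexComb hQ.ringInverse ha hb hab
  set H := Ring.inverse N
  have hH : IsStrictlyPositive H := hN.ringInverse
  have hHN : H * N * H = H := by rw [Ring.inverse_mul_cancel _ hN.isUnit, one_mul]
  have hD := (hΦ P hP).ringInverse.convexComb (hΦ Q hQ).ringInverse ha hb hab
  set D := a • Ring.inverse (Φ P) + b • Ring.inverse (Φ Q)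
  have hK := hΦ H hH
  set K := Φ H with hKdef
  -- Expand `H = HNH` and apply Choi's inequality to each summand.
  have h1 : K * D * K ≤ K := by
    have e1 : K * D * K =
        a • (K * Ring.inverse (Φ P) * K) + b • (K * Ring.inverse (Φ Q) * K) := by
      simp [D, mul_add, add_mul]
    have e2 : K = a • Φ (H * Ring.inverse P * H) + b • Φ (H * Ring.inverse Q * H) := by
      rw [← Φ.map_smul_of_tower, ← Φ.map_smul_of_tower, ← map_add, hKdef]
      conv_lhs => rw [← hHN]
      simp [hNdef, mul_add, add_mul]
    rw [e1]
    conv_rhs => rw [e2]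
    exact add_le_add (smul_le_smul_of_nonneg_left (hΦ.mul_inverse_mul_le hH.nonneg hP) ha)
      (smul_le_smul_of_nonneg_left (hΦ.mul_inverse_mul_le hH.nonneg hQ) hb)
  set J := Ring.inverse K with hJdef
  have hJ : IsStrictlyPositive J := hK.ringInverse
  have hJK : J * K = 1 := Ring.inverse_mul_cancel _ hK.isUnit
  have hKJ : K * J = 1 := Ring.mul_inverse_cancel _ hK.isUnit
  have h2 : D ≤ J := by
    have := star_left_conjugate_le_conjugate h1 J
    rw [hJ.isSelfAdjoint.star_eq, hJK, one_mul,
      show J * (K * D * K) * J = (J * K) * D * (K * J) by simp only [mul_assoc], hJK, hKJ] at this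
    simpa using this
  have h3 := CStarAlgebra.ringInverse_le_ringInverse h2 hD
  rwa [hJdef, Ring.inverse_inverse hK.isUnit] at h3

end Kadison

/-! ### Harmonic mean bounds for `f` and `g`, and the theorem. -/

section Main

variable {A : Type u} [CStarAlgebra A] [PartialOrder A] [StarOrderedRing A]

lemma continuousOn_inv_iff_of_pos {f : ℝ → ℝ} {s : Set ℝ} (hf : ∀ x ∈ s, 0 < f x) :
    ContinuousOn (fun x => (f x)⁻¹) s ↔ ContinuousOn f s := by
  refine ⟨fun h => ?_, fun h => h.inv₀ fun x hx => (hf x hx).ne'⟩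
  simpa [Pi.inv_def] using h.inv₀ fun x hx => (inv_pos.mpr (hf x hx)).ne'

lemma isStrictlyPositive_cfc {f : ℝ → ℝ} {X : A} (hX : IsStrictlyPositive X)
    (hf_pos : ∀ x ∈ Ioi (0 : ℝ), 0 < f x) (hf : ContinuousOn f (spectrum ℝ X)) :
    IsStrictlyPositive (cfc f X) :=
  (cfc_isStrictlyPositive_iff f X hf hX.isSelfAdjoint).mpr
    fun x hx => hf_pos x (hX.spectrum_pos hx)

/-- The reciprocal of a positive operator monotone decreasing function is operator monotone. -/
lemma IsOperatorMonotoneDecreasingOn.inv {f : ℝ → ℝ}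
    (hf : IsOperatorMonotoneDecreasingOn.{u} (Ioi 0) f) (hf_pos : ∀ x ∈ Ioi (0 : ℝ), 0 < f x) :
    IsOperatorMonotoneOn.{u} (Ioi 0) (fun x => (f x)⁻¹) := by
  intro C _ _ _ X Y hX hY hXI hYI hfX hfY hXY
  have hfX' := (continuousOn_inv_iff_of_pos fun x hx => hf_pos x (hXI hx)).mp hfX
  have hfY' := (continuousOn_inv_iff_of_pos fun x hx => hf_pos x (hYI hx)).mp hfY
  have hYp : IsStrictlyPositive Y :=
    (StarOrderedRing.isStrictlyPositive_iff_spectrum_pos (R := ℝ) Y).mpr hYI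
  rw [cfc_inv f X (fun x hx => (hf_pos x (hXI hx)).ne') hfX' hX,
    cfc_inv f Y (fun x hx => (hf_pos x (hYI hx)).ne') hfY' hY]
  exact CStarAlgebra.ringInverse_le_ringInverse (hf C X Y hX hY hXI hYI hfX' hfY' hXY)
    (isStrictlyPositive_cfc hYp hf_pos hfY')

lemma cfc_neg_comp_inv {g : ℝ → ℝ} (hg : ContinuousOn g (Ioi 0)) {X : A}
    (hX : IsStrictlyPositive X) :
    cfc (fun x => -g x⁻¹) X = -cfc g (Ring.inverse X) := by
  have hne : ∀ x ∈ spectrum ℝ X, x ≠ 0 := fun x hx => (hX.spectrum_pos hx).ne'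
  have hinv : ContinuousOn (fun x : ℝ => x⁻¹) (spectrum ℝ X) := continuousOn_id.inv₀ hne
  rw [cfc_neg, cfc_comp' g (fun x => x⁻¹) X (hg.mono ?_) hinv hX.isSelfAdjoint,
    cfc_ringInverse_id (R := ℝ) X hX.isUnit hX.isSelfAdjoint]
  rintro _ ⟨x, hx, rfl⟩
  exact inv_pos.mpr (hX.spectrum_pos hx)

/-- Inversion and negation each reverse the order. -/
lemma IsOperatorMonotoneOn.neg_comp_inv {g : ℝ → ℝ} (hg : IsOperatorMonotoneOn.{u} (Ioi 0) g)
    (hgc : ContinuousOn g (Ioi 0)) :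
    IsOperatorMonotoneOn.{u} (Ioi 0) (fun x => -g x⁻¹) := by
  intro C _ _ _ X Y hX hY hXI hYI _ _ hXY
  have hXp : IsStrictlyPositive X :=
    (StarOrderedRing.isStrictlyPositive_iff_spectrum_pos (R := ℝ) X).mpr hXI
  have hYp := hXp.of_le hXY
  rw [cfc_neg_comp_inv hgc hXp, cfc_neg_comp_inv hgc hYp, neg_le_neg_iff]
  exact hg C _ _ hYp.ringInverse.isSelfAdjoint hXp.ringInverse.isSelfAdjoint
    hYp.ringInverse.spectrum_subset_Ioi hXp.ringInverse.spectrum_subset_Ioi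
    (hgc.mono hYp.ringInverse.spectrum_subset_Ioi)
    (hgc.mono hXp.ringInverse.spectrum_subset_Ioi)
    (CStarAlgebra.ringInverse_le_ringInverse hXY hXp)

/-- An operator monotone function maps weighted harmonic means below weighted arithmetic means. -/
lemma IsOperatorMonotoneOn.cfc_harmonic_le {g : ℝ → ℝ}
    (hg : IsOperatorMonotoneOn.{u} (Ioi 0) g) (hgc : ContinuousOn g (Ioi 0)) {P Q : A}
    (hP : IsStrictlyPositive P) (hQ : IsStrictlyPositive Q) {a b : ℝ} (ha : 0 ≤ a) (hb : 0 ≤ b)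
    (hab : a + b = 1) :
    cfc g (Ring.inverse (a • Ring.inverse P + b • Ring.inverse Q)) ≤
      a • cfc g P + b • cfc g Q := by
  have h := (hg.neg_comp_inv hgc).concaveOn_cfc.2 hP.ringInverse hQ.ringInverse ha hb hab
  dsimp only at h
  rw [cfc_neg_comp_inv hgc hP.ringInverse, cfc_neg_comp_inv hgc hQ.ringInverse,
    cfc_neg_comp_inv hgc (hP.ringInverse.convexComb hQ.ringInverse ha hb hab),
    Ring.inverse_inverse hP.isUnit, Ring.inverse_inverse hQ.isUnit] at h
  rw [← neg_le_neg_iff]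
  refine le_trans (le_of_eq ?_) h
  module

/-- A positive operator monotone decreasing function maps weighted arithmetic means below weighted
harmonic means. -/
lemma IsOperatorMonotoneDecreasingOn.cfc_le_harmonic {f : ℝ → ℝ}
    (hf : IsOperatorMonotoneDecreasingOn.{u} (Ioi 0) f) (hf_pos : ∀ x ∈ Ioi (0 : ℝ), 0 < f x)
    (hfc : ContinuousOn f (Ioi 0)) {X Y : A} (hX : IsStrictlyPositive X)
    (hY : IsStrictlyPositive Y) {a b : ℝ} (ha : 0 ≤ a) (hb : 0 ≤ b) (hab : a + b = 1) :
    cfc f (a • X + b • Y) ≤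
      Ring.inverse (a • Ring.inverse (cfc f X) + b • Ring.inverse (cfc f Y)) := by
  have hW := hX.convexComb hY ha hb hab
  have hfp {Z : A} (hZ : IsStrictlyPositive Z) : IsStrictlyPositive (cfc f Z) :=
    isStrictlyPositive_cfc hZ hf_pos (hfc.mono hZ.spectrum_subset_Ioi)
  have hinv {Z : A} (hZ : IsStrictlyPositive Z) :
      cfc (fun x => (f x)⁻¹) Z = Ring.inverse (cfc f Z) :=
    cfc_inv f Z (fun x hx => (hf_pos x (hZ.spectrum_pos hx)).ne')
      (hfc.mono hZ.spectrum_subset_Ioi) hZ.isSelfAdjoint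
  have h := (hf.inv hf_pos).concaveOn_cfc.2 hX hY ha hb hab
  dsimp only at h
  rw [hinv hX, hinv hY, hinv hW] at h
  have := CStarAlgebra.ringInverse_le_ringInverse h
    ((hfp hX).ringInverse.convexComb (hfp hY).ringInverse ha hb hab)
  rwa [Ring.inverse_inverse (hfp hW).isUnit] at this

end Main

theorem theorem3p1
    {A : Type u} {B : Type v}
    [CStarAlgebra A] [PartialOrder A] [StarOrderedRing A]
    [CStarAlgebra B] [PartialOrder B] [StarOrderedRing B]
    (f g : ℝ → ℝ)
    (hf_pos : ∀ x ∈ Set.Ioi (0 : ℝ), f x ∈ Set.Ioi (0 : ℝ))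
    (hf : IsOperatorMonotoneDecreasingOn.{u} (Set.Ioi 0) f)
    (hg : IsOperatorMonotoneOn.{v} (Set.Ioi 0) g)
    (Φ : A →ₗ[ℂ] B) (hΦ : IsStrictlyPositiveMap Φ) :
    ConvexOn ℝ {X : A | IsStrictlyPositive X} (fun X : A => cfc g (Φ (cfc f X))) := by
  refine ⟨fun X hX Y hY a b ha hb hab => hX.convexComb hY ha hb hab,
    fun X hX Y hY a b ha hb hab => ?_⟩
  have hX : IsStrictlyPositive X := hX
  have hY : IsStrictlyPositive Y := hY
  nontriviality B
  -- Continuity of `f` is extracted from scalars in `A`, so `A` must be nontrivial; otherwise `X =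
  -- Y`.
  rcases subsingleton_or_nontrivial A with _ | _
  · rw [Subsingleton.elim Y X, ← add_smul, ← add_smul, hab, one_smul, one_smul]
  have hgc := hg.continuousOn_Ioi B
  have hfc : ContinuousOn f (Ioi 0) :=
    (continuousOn_inv_iff_of_pos hf_pos).mp ((hf.inv hf_pos).continuousOn_Ioi A)
  have hfp {Z : A} (hZ : IsStrictlyPositive Z) : IsStrictlyPositive (cfc f Z) :=
    isStrictlyPositive_cfc hZ hf_pos (hfc.mono hZ.spectrum_subset_Ioi)
  have hP := hfp hX
  have hQ := hfp hY
  have hL := hΦ _ (hfp (hX.convexComb hY ha hb hab))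
  have hR := ((hΦ _ hP).ringInverse.convexComb (hΦ _ hQ).ringInverse ha hb hab).ringInverse
  have hle : Φ (cfc f (a • X + b • Y)) ≤
      Ring.inverse (a • Ring.inverse (Φ (cfc f X)) + b • Ring.inverse (Φ (cfc f Y))) := by
    refine le_trans ?_ (hΦ.map_harmonic_le hP hQ ha hb hab)
    rw [← sub_nonneg, ← map_sub]
    exact hΦ.map_nonneg (sub_nonneg.mpr (hf.cfc_le_harmonic hf_pos hfc hX hY ha hb hab))
  exact (hg B _ _ hL.isSelfAdjoint hR.isSelfAdjoint hL.spectrum_subset_Ioi hR.spectrum_subset_Ioi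
    (hgc.mono hL.spectrum_subset_Ioi) (hgc.mono hR.spectrum_subset_Ioi) hle).trans
    (hg.cfc_harmonic_le hgc (hΦ _ hP) (hΦ _ hQ) ha hb hab)
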